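/- Let $A$ be a $C^*$-algebra with a countable approximate identity, and let $a\in A$ be a strictly positive element, that is, an element such that $aAa$ is dense in $A$. Let $\mathrm{Prim}(A)$ be the set of primitive ideals of $A$ (the kernels of the nonzero irreducible $*$-representations of $A$ on Hilbert spaces) with the hull-kernel topology, and write $P\approx Q$ for $P,Q\in\mathrm{Prim}(A)$ if $f(P)=f(Q)$ for every bounded continuous function $f:\mathrm{Prim}(A)\to\mathbb{R}$. Let $\mathrm{Glimm}(A)$ be the set of the ideals $q_A(P):=\bigcap\{Q\in\mathrm{Prim}(A) : Q\approx P\}$, $P\in \mathrm{Prim}(A)$, with the topology $\tau_{cr}$, the weakest topology for which every function $g:\mathrm{Glimm}(A)\to\mathbb{R}$ such that $g\circ q_A$ is bounded and continuous on $\mathrm{Prim}(A)$ is continuous. Then for every $\tau_{cr}$-compact subset $K$ of $\mathrm{Glimm}(A)$ there exists $\alpha>0$ such that $$K\subset\{G\in\mathrm{Glimm}(A) : \|a+G\|\geq\alpha\},$$ where $\|a+G\|$ is the norm of the image of $a$ in the quotient $A/G$. -/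

import Mathlib

open Filter Topology
open scoped BoundedContinuousFunction

universe u

namespace GlimmSpace

/-- A (topologically) irreducible representation of a `C⋆`-algebra on a Hilbert space: a nonzero
`⋆`-representation whose only closed invariant subspaces are `0` and the whole space. -/
structure IsIrreducibleRep {A : Type u} [NonUnitalCStarAlgebra A]
    {H : Type u} [NormedAddCommGroup H] [InnerProductSpace ℂ H] [CompleteSpace H]
    (π : A →⋆ₙₐ[ℂ] (H →L[ℂ] H)) : Prop where
  ne_zero : ∃ x : A, π x ≠ 0
  eq_bot_or_eq_top : ∀ V : Submodule ℂ H, IsClosed (V : Set H) →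
    (∀ x : A, ∀ v ∈ V, π x v ∈ V) → V = ⊥ ∨ V = ⊤

/-- A primitive ideal is the kernel of an irreducible representation. (The space of an irreducible
representation of `A` is the completion of a quotient of `A`, so that the universe of `A` is
large enough.) -/
def IsPrimitiveIdeal {A : Type u} [NonUnitalCStarAlgebra A] (P : TwoSidedIdeal A) : Prop :=
  ∃ (H : Type u) (_ : NormedAddCommGroup H) (_ : InnerProductSpace ℂ H) (_ : CompleteSpace H)
    (π : A →⋆ₙₐ[ℂ] (H →L[ℂ] H)), IsIrreducibleRep π ∧ P = TwoSidedIdeal.ker π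

/-- The set `Prim(A)` of primitive ideals of `A`. -/
def Prim (A : Type u) [NonUnitalCStarAlgebra A] : Type u :=
  {P : TwoSidedIdeal A // IsPrimitiveIdeal P}

/-- The hull of an ideal: the primitive ideals that contain it. -/
def hull {A : Type u} [NonUnitalCStarAlgebra A] (I : TwoSidedIdeal A) : Set (Prim A) :=
  {P | I ≤ P.1}

theorem IsPrimitiveIdeal.ne_top {A : Type u} [NonUnitalCStarAlgebra A] {P : TwoSidedIdeal A}
    (hP : IsPrimitiveIdeal P) : ¬ (⊤ : TwoSidedIdeal A) ≤ P := by
  obtain ⟨H, _, _, _, π, hπ, rfl⟩ := hP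
  intro h
  obtain ⟨x, hx⟩ := hπ.ne_zero
  exact hx ((TwoSidedIdeal.mem_ker π).1 (h (TwoSidedIdeal.mem_top A)))

/-- Primitive ideals are prime. -/
theorem IsPrimitiveIdeal.prime {A : Type u} [NonUnitalCStarAlgebra A] {P : TwoSidedIdeal A}
    (hP : IsPrimitiveIdeal P) {I J : TwoSidedIdeal A} (h : I ⊓ J ≤ P) : I ≤ P ∨ J ≤ P := by
  obtain ⟨H, _, _, _, π, hπ, rfl⟩ := hP
  let W : Submodule ℂ H := ⨅ c : I, LinearMap.ker (π c.1 : H →ₗ[ℂ] H)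
  have mem_W : ∀ v, v ∈ W ↔ ∀ c ∈ I, π c v = 0 := fun v => by
    simp [W, Submodule.mem_iInf]
  have hclosed : IsClosed (W : Set H) := by
    have : (W : Set H) = ⋂ c : I, {v | π c.1 v = 0} := by
      ext v; simp [mem_W]
    rw [this]
    exact isClosed_iInter fun c => isClosed_eq (π c.1).continuous continuous_const
  have hinv : ∀ x : A, ∀ v ∈ W, π x v ∈ W := fun x v hv => by
    rw [mem_W] at hv ⊢
    intro c hc
    have := hv (c * x) (I.mul_mem_right c x hc)
    rwa [map_mul] at this
  rcases hπ.eq_bot_or_eq_top W hclosed hinv with hW | hW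
  · right
    intro y hy
    rw [TwoSidedIdeal.mem_ker]
    ext v
    have hv : π y v ∈ W := (mem_W _).2 fun c hc => by
      have hm : c * y ∈ TwoSidedIdeal.ker π :=
        h ((TwoSidedIdeal.mem_inf A).2 ⟨I.mul_mem_right c y hc, J.mul_mem_left c y hy⟩)
      rw [TwoSidedIdeal.mem_ker, map_mul] at hm
      exact congrArg (fun T : H →L[ℂ] H => T v) hm
    rw [hW] at hv
    simpa using hv
  · left
    intro c hc
    rw [TwoSidedIdeal.mem_ker]
    ext v
    have hv : v ∈ W := hW ▸ Submodule.mem_top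
    simpa using (mem_W v).1 hv c hc

/-- The hull-kernel (Jacobson) topology on `Prim(A)`: the closed sets are the hulls of ideals. -/
instance (A : Type u) [NonUnitalCStarAlgebra A] : TopologicalSpace (Prim A) :=
  TopologicalSpace.ofClosed (Set.range (hull (A := A)))
    ⟨⊤, by
      ext P
      simpa [hull] using P.2.ne_top⟩
    (fun S hS => ⟨sSup {I | hull I ∈ S}, by
      ext P
      simp only [hull, Set.mem_ofPred_eq, Set.mem_sInter, sSup_le_iff]
      constructor
      · intro h t ht
        obtain ⟨I, rfl⟩ := hS ht
        exact h I ht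
      · intro h I hI
        exact h _ hI⟩)
    (by
      rintro _ ⟨I, rfl⟩ _ ⟨J, rfl⟩
      refine ⟨I ⊓ J, ?_⟩
      ext P
      change I ⊓ J ≤ P.1 ↔ I ≤ P.1 ∨ J ≤ P.1
      exact ⟨P.2.prime, fun h => h.elim inf_le_left.trans inf_le_right.trans⟩)

theorem isClosed_iff_hull {A : Type u} [NonUnitalCStarAlgebra A] {F : Set (Prim A)} :
    IsClosed F ↔ ∃ I : TwoSidedIdeal A, hull I = F := by
  rw [← isOpen_compl_iff]
  change Fᶜᶜ ∈ Set.range (hull (A := A)) ↔ _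
  rw [compl_compl]
  rfl

/-- `P ≈ Q` if no bounded continuous real function on `Prim(A)` separates `P` from `Q`. -/
def Equivalent {A : Type u} [NonUnitalCStarAlgebra A] (P Q : Prim A) : Prop :=
  ∀ f : Prim A →ᵇ ℝ, f P = f Q

/-- The kernel of the equivalence class of `P`, i.e. the intersection of the primitive ideals
equivalent to `P`. -/
def glimmIdeal {A : Type u} [NonUnitalCStarAlgebra A] (P : Prim A) : TwoSidedIdeal A :=
  sInf {I | ∃ Q : Prim A, Equivalent P Q ∧ I = Q.1}

/-- The set `Glimm(A)` of the kernels of the equivalence classes. -/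
def Glimm (A : Type u) [NonUnitalCStarAlgebra A] : Type u :=
  {G : TwoSidedIdeal A // ∃ P : Prim A, glimmIdeal P = G}

/-- The quotient map `q_A : Prim(A) → Glimm(A)`. -/
def quotientMap {A : Type u} [NonUnitalCStarAlgebra A] (P : Prim A) : Glimm A :=
  ⟨glimmIdeal P, P, rfl⟩

/-- `Glimm(A)` is the quotient of `Prim(A)` by the equivalence relation; in particular, every
bounded continuous function on `Prim(A)` drops to `Glimm(A)`. -/
theorem quotientMap_eq_iff {A : Type u} [NonUnitalCStarAlgebra A] {P Q : Prim A} :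
    quotientMap P = quotientMap Q ↔ Equivalent P Q := by
  constructor
  · intro h
    have h' : glimmIdeal P = glimmIdeal Q := congrArg Subtype.val h
    have hc : IsClosed {R : Prim A | Equivalent P R} := by
      have : {R : Prim A | Equivalent P R} = ⋂ f : Prim A →ᵇ ℝ, {R | f P = f R} := by
        ext R; simp [Equivalent]
      rw [this]
      exact isClosed_iInter fun f => isClosed_eq continuous_const f.continuous
    obtain ⟨I, hI⟩ := isClosed_iff_hull.1 hc
    have h1 : I ≤ glimmIdeal P := by
      refine le_sInf ?_
      rintro _ ⟨R, hR, rfl⟩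
      have : R ∈ hull I := hI ▸ hR
      exact this
    have h2 : glimmIdeal Q ≤ Q.1 := sInf_le ⟨Q, fun _ => rfl, rfl⟩
    have : Q ∈ hull I := (h1.trans h'.le).trans h2
    rw [hI] at this
    exact this
  · intro h
    refine Subtype.ext ?_
    have : ∀ R, Equivalent P R ↔ Equivalent Q R := fun R =>
      ⟨fun k f => (h f).symm.trans (k f), fun k f => (h f).trans (k f)⟩
    simp only [quotientMap, glimmIdeal, this]

/-- The topology `τ_cr` on `Glimm(A)`: the weakest one for which the functions obtained by dropping
to `Glimm(A)` the bounded continuous real functions on `Prim(A)` are continuous. -/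
instance (A : Type u) [NonUnitalCStarAlgebra A] : TopologicalSpace (Glimm A) :=
  ⨅ g ∈ {g : Glimm A → ℝ | ∃ f : Prim A →ᵇ ℝ, ∀ P, g (quotientMap P) = f P},
    TopologicalSpace.induced g inferInstance

/-- The norm `‖x + I‖` of the image of `x` in the quotient `A / I`. -/
noncomputable def quotientNorm {A : Type u} [NonUnitalCStarAlgebra A] (x : A)
    (I : TwoSidedIdeal A) : ℝ :=
  ‖(QuotientAddGroup.mk x : A ⧸ AddSubgroup.ofClass I)‖

/-- `A` is `σ`-unital: it has a (two-sided) countable approximate identity. -/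
def HasCountableApproximateIdentity (A : Type u) [NonUnitalCStarAlgebra A] : Prop :=
  ∃ e : ℕ → A, (Filter.map e atTop).IsApproximateUnit

/-- The element `a` is strictly positive in the sense that `aAa` is dense in `A`. (That `a` be
positive, as is usual, is not required.) -/
def IsStrictlyPositiveElement {A : Type u} [NonUnitalCStarAlgebra A] (a : A) : Prop :=
  Dense {y : A | ∃ x : A, y = a * x * a}

end GlimmSpace

/-! Put `b = star a * a`. If no `α` works, there are points `P n` over `K` at which the norm of `a`
modulo the Glimm ideal is below `δ n = 1 / (n + 1)`. Then `b` has norm at most `δ n ^ 2` at every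
point equivalent to `P n`. Suppose there are continuous `f n ≥ 0` on `Prim A` with `f n (P n) = 1`
that vanish where `b` is larger than `2 * δ n ^ 2`. Since `a`, hence `b`, lies in no primitive
ideal, the open sets where `b` is larger than `ε > 0` cover `Prim A`, and each meets the supports of
only finitely many `f n`. So `F = ∑ n * f n` is continuous, and `F (P n) ≥ n`. Truncations of `F`
drop to `Glimm A`, so compactness of `K` bounds `F` over `K`: a contradiction.

The functions `f n` come from a compactness property: an open cover of the set where `b` exceeds `ε`
has a finite subfamily covering the set where `b` exceeds `ε' > ε`
(`exists_finset_thresholdSet_subset`). It rests on the fact that a point outside the closure of a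
self-adjoint ideal is avoided by some primitive ideal containing that ideal
(`exists_prim_of_notMem_closure`), proved by Hahn–Banach, Krein–Milman and GNS. -/

namespace GlimmSpace

open scoped ComplexOrder InnerProductSpace

/-! ### States vanishing on an ideal of a unital algebra -/

section Unital

variable {B : Type u} [CStarAlgebra B] [PartialOrder B] [StarOrderedRing B]

/-- The states of a unital `C⋆`-algebra that vanish on `T`, as a subset of a product space. -/
def statesVanishingOn (T : Submodule ℂ B) : Set (B → ℂ) :=
  {φ | (∀ x y, φ (x + y) = φ x + φ y) ∧ (∀ (r : ℂ) x, φ (r • x) = r * φ x) ∧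
    (∀ x, 0 ≤ φ (star x * x)) ∧ φ 1 = 1 ∧ ∀ s ∈ T, φ s = 0}

/-- A state as a positive linear functional. -/
noncomputable def toPositiveLinearMap {T : Submodule ℂ B} {φ : B → ℂ}
    (hφ : φ ∈ statesVanishingOn T) : B →ₚ[ℂ] ℂ :=
  PositiveLinearMap.mk₀ { toFun := φ, map_add' := hφ.1, map_smul' := hφ.2.1 } (by
    intro x hx
    obtain ⟨y, rfl⟩ := CStarAlgebra.nonneg_iff_eq_star_mul_self.1 hx
    exact hφ.2.2.1 y)

@[simp]
theorem toPositiveLinearMap_apply {T : Submodule ℂ B} {φ : B → ℂ}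
    (hφ : φ ∈ statesVanishingOn T) (x : B) : toPositiveLinearMap hφ x = φ x := rfl

/-- Positivity and `φ 1 = 1` give the bound `‖y‖` on self-adjoint `y`. The factor 2 comes from
splitting into real and imaginary parts; it is not sharp, but any pointwise bound suffices for
compactness. -/
theorem norm_le_two_mul_of_mem_statesVanishingOn {T : Submodule ℂ B} {φ : B → ℂ}
    (hφ : φ ∈ statesVanishingOn T) (x : B) : ‖φ x‖ ≤ 2 * ‖x‖ := by
  have key : ∀ y : B, IsSelfAdjoint y → ‖φ y‖ ≤ ‖y‖ := by
    intro y hy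
    have h1 := (toPositiveLinearMap hφ).apply_le_of_isSelfAdjoint y hy
    have h2 := (toPositiveLinearMap hφ).apply_le_of_isSelfAdjoint (-y) hy.neg
    have h3 : ∀ r : ℝ, φ (algebraMap ℝ B r) = r := by
      intro r
      have : algebraMap ℝ B r = (r : ℂ) • (1 : B) := by
        rw [Algebra.algebraMap_eq_smul_one]; exact (Complex.coe_smul r (1 : B)).symm
      rw [this, hφ.2.1, hφ.2.2.2.1, mul_one]
    rw [map_neg, norm_neg] at h2
    simp only [toPositiveLinearMap_apply, h3] at h1 h2
    have h4 := Complex.le_def.1 h1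
    have h5 := Complex.le_def.1 h2
    simp only [Complex.ofReal_re, Complex.ofReal_im, Complex.neg_re] at h4 h5
    have h6 : φ y = ((φ y).re : ℂ) := Complex.ext rfl (by simpa using h4.2)
    rw [h6, Complex.norm_real, Real.norm_eq_abs, abs_le]
    constructor <;> linarith [h4.1, h5.1]
  have hx := realPart_add_I_smul_imaginaryPart x
  have h1 : φ x = φ (realPart x : B) + Complex.I * φ (imaginaryPart x : B) := by
    conv_lhs => rw [← hx, hφ.1, hφ.2.1]
  rw [h1]
  refine (norm_add_le _ _).trans ?_
  rw [norm_mul, Complex.norm_I, one_mul, two_mul]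
  exact add_le_add ((key _ (realPart x).2).trans (realPart.norm_le x))
    ((key _ (imaginaryPart x).2).trans (imaginaryPart.norm_le x))

theorem isCompact_statesVanishingOn (T : Submodule ℂ B) : IsCompact (statesVanishingOn T) := by
  refine (isCompact_univ_pi fun x : B => isCompact_closedBall (0 : ℂ) (2 * ‖x‖)).of_isClosed_subset
    ?_ fun φ hφ x _ => by
      simpa using norm_le_two_mul_of_mem_statesVanishingOn hφ x
  have hc : ∀ x : B, Continuous fun φ : B → ℂ => φ x := fun x => continuous_apply x
  simp only [statesVanishingOn, Set.ofPred_and, Set.ofPred_forall]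
  refine IsClosed.inter ?_ (IsClosed.inter ?_ (IsClosed.inter ?_ (IsClosed.inter ?_ ?_)))
  · exact isClosed_iInter fun x => isClosed_iInter fun y => isClosed_eq (hc _) ((hc _).add (hc _))
  · exact isClosed_iInter fun r => isClosed_iInter fun x =>
      isClosed_eq (hc _) (continuous_const.mul (hc _))
  · exact isClosed_iInter fun x => isClosed_le continuous_const (hc _)
  · exact isClosed_eq (hc _) continuous_const
  · exact isClosed_iInter fun s => isClosed_iInter fun _ => isClosed_eq (hc _) continuous_const

/-- If a state vanishing on `T` does not vanish on `star c * c`, then neither does some extreme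
one. -/
theorem exists_extremePoint_statesVanishingOn {T : Submodule ℂ B} {c : B}
    (h : ∃ φ ∈ statesVanishingOn T, φ (star c * c) ≠ 0) :
    ∃ ψ ∈ (statesVanishingOn T).extremePoints ℝ, ψ (star c * c) ≠ 0 := by
  obtain ⟨φ, hφ, hφc⟩ := h
  let l : (B → ℂ) →L[ℝ] ℝ :=
    Complex.reCLM.comp (ContinuousLinearMap.proj (R := ℝ) (φ := fun _ : B => ℂ) (star c * c))
  -- The maximizers of `Re φ (star c * c)` form a compact exposed face, and an extreme point of a
  -- face is extreme in the whole set.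
  have hE : IsExposed ℝ (statesVanishingOn T)
      {z ∈ statesVanishingOn T | ∀ w ∈ statesVanishingOn T, l w ≤ l z} := fun _ => ⟨l, rfl⟩
  obtain ⟨z, hz, hz'⟩ := (isCompact_statesVanishingOn T).exists_isMaxOn ⟨φ, hφ⟩
    l.continuous.continuousOn
  obtain ⟨ψ, hψ⟩ := (hE.isCompact (isCompact_statesVanishingOn T)).extremePoints_nonempty
    ⟨z, hz, hz'⟩
  refine ⟨ψ, hE.isExtreme.extremePoints_subset_extremePoints hψ, fun h0 => hφc ?_⟩
  have h1 : (φ (star c * c)).re ≤ (ψ (star c * c)).re := hψ.1.2 φ hφ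
  have h2 := Complex.le_def.1 (hφ.2.2.1 c)
  rw [h0] at h1
  exact Complex.ext (le_antisymm h1 h2.1) h2.2.symm

/-- An element whose square modulus is dominated, up to arbitrarily small constants, by a
self-adjoint element of a two-sided ideal lies in the closure of this ideal. -/
theorem mem_closure_of_star_mul_self_le {T : Submodule ℂ B} (hl : ∀ x, ∀ s ∈ T, x * s ∈ T)
    (hr : ∀ x, ∀ s ∈ T, s * x ∈ T) {c : B}
    (h : ∀ δ : ℝ, 0 < δ → ∃ s ∈ T, IsSelfAdjoint s ∧ star c * c ≤ algebraMap ℝ B δ + s) :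
    c ∈ closure (T : Set B) := by
  rw [Metric.mem_closure_iff]
  intro ε hε
  set δ : ℝ := ε ^ 2 / 4 with hδ
  have hδ0 : 0 < δ := by positivity
  obtain ⟨s, hsT, hs, hle⟩ := h δ hδ0
  have hpos : ∀ t : ℝ, t ^ 2 + δ ^ 2 ≠ 0 := fun t => by positivity
  -- `1 - w` is a multiple of `s`, so it lies in `T` although `T` need not be closed. The error
  -- satisfies `‖c * w‖ ^ 2 ≤ ‖w * (δ + s) * w‖ ≤ 2 * δ = ε ^ 2 / 2`.
  set w : B := cfc (fun t : ℝ => δ ^ 2 / (t ^ 2 + δ ^ 2)) s with hw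
  have hc1 : Continuous fun t : ℝ => δ ^ 2 / (t ^ 2 + δ ^ 2) := by fun_prop (disch := exact hpos _)
  have hc2 : Continuous fun t : ℝ => t / (t ^ 2 + δ ^ 2) := by fun_prop (disch := exact hpos _)
  have hwsa : IsSelfAdjoint w := cfc_predicate _ _
  have h1w : 1 - w = s * cfc (fun t : ℝ => t / (t ^ 2 + δ ^ 2)) s := by
    have h := cfc_mul (fun t : ℝ => t) (fun t : ℝ => t / (t ^ 2 + δ ^ 2)) s (by fun_prop)
      hc2.continuousOn
    rw [cfc_id' ℝ s] at h
    rw [← h, hw, ← cfc_const_one ℝ s, ← cfc_sub ..]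
    congr 1
    funext t
    have := hpos t
    field_simp
    ring
  have hu : 1 - w ∈ T := by
    rw [h1w]; exact hr _ _ hsT
  refine ⟨c * (1 - w), hl _ _ hu, ?_⟩
  have hdist : dist c (c * (1 - w)) = ‖c * w‖ := by
    rw [dist_eq_norm]; congr 1; rw [mul_sub, mul_one]; abel
  have hsq : ‖c * w‖ * ‖c * w‖ = ‖w * (star c * c) * w‖ := by
    rw [← CStarRing.norm_star_mul_self, star_mul, hwsa.star_eq]; simp only [mul_assoc]
  have h2 : w * (star c * c) * w ≤ w * (algebraMap ℝ B δ + s) * w := hwsa.conjugate_le_conjugate hle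
  have h0 : 0 ≤ w * (star c * c) * w := hwsa.conjugate_nonneg (star_mul_self_nonneg c)
  have h3 : w * (algebraMap ℝ B δ + s) * w =
      cfc (fun t : ℝ => δ ^ 2 / (t ^ 2 + δ ^ 2) * (δ + t) * (δ ^ 2 / (t ^ 2 + δ ^ 2))) s := by
    rw [cfc_mul (fun t : ℝ => δ ^ 2 / (t ^ 2 + δ ^ 2) * (δ + t)) _ s
      (hc1.mul (continuous_const.add continuous_id)).continuousOn hc1.continuousOn,
      cfc_mul _ (fun t : ℝ => δ + t) s hc1.continuousOn (by fun_prop),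
      cfc_const_add δ (fun t : ℝ => t) s, cfc_id' ℝ s]
  have h4 : ‖w * (algebraMap ℝ B δ + s) * w‖ ≤ 2 * δ := by
    rw [h3]
    refine norm_cfc_le (by positivity) fun t _ => ?_
    have hp : 0 < t ^ 2 + δ ^ 2 := by positivity
    have : δ ^ 2 / (t ^ 2 + δ ^ 2) * (δ + t) * (δ ^ 2 / (t ^ 2 + δ ^ 2)) =
      δ ^ 4 * (δ + t) / (t ^ 2 + δ ^ 2) ^ 2 := by field_simp
    rw [this, Real.norm_eq_abs, abs_div, abs_of_pos (by positivity : 0 < (t ^ 2 + δ ^ 2) ^ 2),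
      div_le_iff₀ (by positivity), abs_mul, abs_of_pos (by positivity : 0 < δ ^ 4)]
    have ht : |δ + t| ≤ δ + |t| := (abs_add_le _ _).trans (by rw [abs_of_pos hδ0])
    have h5 : δ * |t| ≤ t ^ 2 + δ ^ 2 := by
      nlinarith [sq_nonneg (δ - |t|), sq_abs t]
    have h6 : δ ^ 2 ≤ t ^ 2 + δ ^ 2 := by nlinarith [sq_nonneg t]
    have h7 : δ ^ 2 * (δ * |t|) ≤ (t ^ 2 + δ ^ 2) ^ 2 := by
      rw [sq (t ^ 2 + δ ^ 2)]; gcongr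
    have h8 : δ ^ 2 * δ ^ 2 ≤ (t ^ 2 + δ ^ 2) ^ 2 := by
      rw [sq (t ^ 2 + δ ^ 2)]; gcongr
    calc δ ^ 4 * |δ + t| ≤ δ ^ 4 * (δ + |t|) := by gcongr
      _ = δ * (δ ^ 2 * δ ^ 2 + δ ^ 2 * (δ * |t|)) := by ring
      _ ≤ δ * ((t ^ 2 + δ ^ 2) ^ 2 + (t ^ 2 + δ ^ 2) ^ 2) := by gcongr
      _ = _ := by ring
  have h5 := (CStarAlgebra.norm_le_norm_of_nonneg_of_le h0 h2).trans h4
  rw [hdist]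
  rw [← hsq] at h5
  by_contra hcon
  push Not at hcon
  nlinarith

/-- Separation of a point from the closure of a self-adjoint two-sided ideal by a state. -/
theorem exists_mem_statesVanishingOn {T : Submodule ℂ B} (hl : ∀ x, ∀ s ∈ T, x * s ∈ T)
    (hr : ∀ x, ∀ s ∈ T, s * x ∈ T) (hs : ∀ s ∈ T, star s ∈ T) {c : B}
    (hc : c ∉ closure (T : Set B)) : ∃ φ ∈ statesVanishingOn T, φ (star c * c) ≠ 0 := by
  -- A real functional that is nonnegative on this cone is positive, and it vanishes on the
  -- self-adjoint part of `T`.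
  let M : Set B := {x | ∃ p s : B, 0 ≤ p ∧ s ∈ T ∧ IsSelfAdjoint s ∧ x = p + s}
  have hM : Convex ℝ M := by
    rintro _ ⟨p, s, hp, hsT, hss, rfl⟩ _ ⟨p', s', hp', hsT', hss', rfl⟩ α β hα hβ -
    have hsm : ∀ (r : ℝ) (y : B), y ∈ T → r • y ∈ T := fun r y hy => by
      rw [← Complex.coe_smul]; exact T.smul_mem _ hy
    refine ⟨α • p + β • p', α • s + β • s', add_nonneg (smul_nonneg hα hp) (smul_nonneg hβ hp'),
      T.add_mem (hsm _ _ hsT) (hsm _ _ hsT'),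
      ((IsSelfAdjoint.all α).smul hss).add ((IsSelfAdjoint.all β).smul hss'), ?_⟩
    rw [smul_add, smul_add]; abel
  have hcM : -(star c * c) ∉ closure M := by
    intro hcl
    refine hc (mem_closure_of_star_mul_self_le hl hr fun δ hδ => ?_)
    obtain ⟨_, ⟨p, s, hp, hsT, hss, rfl⟩, hd⟩ := Metric.mem_closure_iff.1 hcl δ hδ
    refine ⟨-s, T.neg_mem hsT, hss.neg, ?_⟩
    have hsa : IsSelfAdjoint (star c * c + p + s) :=
      ((IsSelfAdjoint.star_mul_self c).add (IsSelfAdjoint.of_nonneg hp)).add hss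
    have h1 := hsa.le_algebraMap_norm_self
    have h2 : ‖star c * c + p + s‖ ≤ δ := by
      have h : star c * c + p + s = -(-(star c * c) - (p + s)) := by abel
      rw [h, norm_neg, ← dist_eq_norm]
      exact hd.le
    have h3 : algebraMap ℝ B ‖star c * c + p + s‖ ≤ algebraMap ℝ B δ := algebraMap_mono B h2
    rw [← sub_eq_add_neg, le_sub_iff_add_le]
    refine le_trans ?_ (h1.trans h3)
    exact add_le_add_left (le_add_of_nonneg_right hp) s
  obtain ⟨F, u, hFu, hu⟩ :=
    RCLike.geometric_hahn_banach_point_closed (𝕜 := ℂ) hM.closure isClosed_closure hcM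
  have hu' : ∀ m ∈ M, u < (F m).re := fun m hm => hu m (subset_closure hm)
  have hu0 : u < 0 := by simpa using hu' 0 ⟨0, 0, le_rfl, T.zero_mem, .zero _, by simp⟩
  have hcpos : 0 < (F (star c * c)).re := by
    have : (F (-(star c * c))).re < u := hFu
    rw [map_neg, Complex.neg_re] at this
    linarith
  -- If `F` had negative real part `v` at a point of the cone, rescaling that point by `u / v` would
  -- give the value `u` exactly, against the strict bound.
  have hscale : ∀ m ∈ M, 0 ≤ (F m).re := by
    rintro _ ⟨p, s, hp, hsT, hss, rfl⟩
    by_contra! hneg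
    set v := (F (p + s)).re with hv
    have hk : 0 ≤ u / v := (div_pos_of_neg_of_neg hu0 hneg).le
    have := hu' ((u / v : ℝ) • (p + s)) ⟨(u / v : ℝ) • p, (u / v : ℝ) • s, smul_nonneg hk hp, by
      rw [← Complex.coe_smul]; exact T.smul_mem _ hsT, (IsSelfAdjoint.all _).smul hss, smul_add ..⟩
    rw [← Complex.coe_smul, map_smul, smul_eq_mul, Complex.re_ofReal_mul, ← hv,
      div_mul_cancel₀ _ hneg.ne] at this
    exact lt_irrefl _ this
  have hTsa : ∀ s ∈ T, IsSelfAdjoint s → (F s).re = 0 := by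
    intro s hsT hss
    have h1 := hscale s ⟨0, s, le_rfl, hsT, hss, by simp⟩
    have h2 := hscale (-s) ⟨0, -s, le_rfl, T.neg_mem hsT, hss.neg, by simp⟩
    rw [map_neg, Complex.neg_re] at h2
    linarith
  have hpos : ∀ p : B, 0 ≤ p → 0 ≤ (F p).re := fun p hp =>
    hscale p ⟨p, 0, hp, T.zero_mem, .zero _, by simp⟩
  -- Only real parts of `F` on self-adjoint elements are controlled, so `F` is replaced by its
  -- hermitian symmetrization.
  let φ : B → ℂ := fun x => F x + star (F (star x))
  have hφsa : ∀ x, IsSelfAdjoint x → φ x = ((2 * (F x).re : ℝ) : ℂ) := by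
    intro x hx
    simp only [φ, hx.star_eq]
    exact Complex.add_conj _
  have hφadd : ∀ x y, φ (x + y) = φ x + φ y := fun x y => by simp only [φ, star_add, map_add]; ring
  have hφsmul : ∀ (r : ℂ) x, φ (r • x) = r * φ x := fun r x => by
    simp only [φ, star_smul, map_smul, smul_eq_mul, star_mul', star_star]; ring
  have h1pos : 0 < (F 1).re := by
    have h := hpos (algebraMap ℝ B ‖star c * c‖ - star c * c)
      (sub_nonneg.2 (IsSelfAdjoint.star_mul_self c).le_algebraMap_norm_self)
    rw [map_sub, Complex.sub_re, Algebra.algebraMap_eq_smul_one, ← Complex.coe_smul, map_smul,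
      smul_eq_mul, Complex.re_ofReal_mul] at h
    by_contra! hle
    nlinarith [norm_nonneg (star c * c)]
  have hφ1 : φ 1 = ((2 * (F 1).re : ℝ) : ℂ) := hφsa 1 (.one B)
  have hφ1' : φ 1 ≠ 0 := by
    rw [hφ1]; exact_mod_cast (by positivity : (2 * (F 1).re) ≠ 0)
  have hφT : ∀ s ∈ T, φ s = 0 := by
    intro s hsT
    have hre : (realPart s : B) ∈ T := by
      rw [realPart_apply_coe, ← Complex.coe_smul]
      exact T.smul_mem _ (T.add_mem hsT (hs s hsT))
    have him : (imaginaryPart s : B) ∈ T := by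
      rw [imaginaryPart_apply_coe, ← Complex.coe_smul (2⁻¹ : ℝ)]
      exact T.smul_mem _ (T.smul_mem _ (T.sub_mem hsT (hs s hsT)))
    rw [← realPart_add_I_smul_imaginaryPart s, hφadd, hφsmul, hφsa _ (realPart s).2,
      hφsa _ (imaginaryPart s).2, hTsa _ hre (realPart s).2, hTsa _ him (imaginaryPart s).2]
    simp
  refine ⟨fun x => (φ 1)⁻¹ * φ x, ⟨fun x y => ?_, fun r x => ?_, fun x => ?_, ?_, ?_⟩, ?_⟩
  · simp only [hφadd]; ring
  · simp only [hφsmul]; ring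
  · simp only [hφ1, hφsa _ (IsSelfAdjoint.star_mul_self x)]
    rw [← Complex.ofReal_inv, ← Complex.ofReal_mul]
    have := hpos _ (star_mul_self_nonneg x)
    exact_mod_cast (by positivity : 0 ≤ (2 * (F 1).re)⁻¹ * (2 * (F (star x * x)).re))
  · exact inv_mul_cancel₀ hφ1'
  · intro s hsT
    simp only [hφT s hsT, mul_zero]
  · simp only [hφsa _ (IsSelfAdjoint.star_mul_self c)]
    refine mul_ne_zero (inv_ne_zero hφ1') ?_
    exact_mod_cast (by positivity : (2 * (F (star c * c)).re) ≠ 0)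

end Unital

/-! ### GNS representations of extreme states -/

section GNS

variable {B : Type u} [CStarAlgebra B] [PartialOrder B] [StarOrderedRing B]

/-- The canonical cyclic vector of the GNS space. -/
noncomputable def cyclicVector (f : B →ₚ[ℂ] ℂ) : f.GNS := ((f.toPreGNS 1 : f.PreGNS) : f.GNS)

theorem gns_apply_cyclicVector (f : B →ₚ[ℂ] ℂ) (x : B) :
    f.gnsNonUnitalStarAlgHom x (cyclicVector f) = ((f.toPreGNS x : f.PreGNS) : f.GNS) := by
  simp [cyclicVector]

theorem gns_one (f : B →ₚ[ℂ] ℂ) : f.gnsNonUnitalStarAlgHom 1 = 1 := f.gnsStarAlgHom.map_one'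

theorem dense_range_gns_cyclicVector (f : B →ₚ[ℂ] ℂ) :
    DenseRange fun x => f.gnsNonUnitalStarAlgHom x (cyclicVector f) := by
  simp only [gns_apply_cyclicVector]
  exact UniformSpace.Completion.denseRange_coe.comp f.toPreGNS.surjective.denseRange
    (UniformSpace.Completion.continuous_coe _)

theorem inner_gns_cyclicVector (f : B →ₚ[ℂ] ℂ) (x y : B) :
    ⟪f.gnsNonUnitalStarAlgHom x (cyclicVector f), f.gnsNonUnitalStarAlgHom y (cyclicVector f)⟫_ℂ =
      f (star x * y) := by
  rw [gns_apply_cyclicVector, gns_apply_cyclicVector, UniformSpace.Completion.inner_coe,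
    PositiveLinearMap.preGNS_inner_def]
  simp

theorem gns_eq_zero {T : Submodule ℂ B} (hl : ∀ x, ∀ s ∈ T, x * s ∈ T)
    (hr : ∀ x, ∀ s ∈ T, s * x ∈ T) (f : B →ₚ[ℂ] ℂ) (hf : ∀ s ∈ T, f s = 0) {s : B} (hs : s ∈ T) :
    f.gnsNonUnitalStarAlgHom s = 0 := by
  have h : (fun v => f.gnsNonUnitalStarAlgHom s v) = fun _ => 0 := by
    refine (dense_range_gns_cyclicVector f).equalizer (by fun_prop) continuous_const ?_
    funext x
    have : f.gnsNonUnitalStarAlgHom s (f.gnsNonUnitalStarAlgHom x (cyclicVector f)) =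
        f.gnsNonUnitalStarAlgHom (s * x) (cyclicVector f) := by rw [map_mul]; rfl
    simp only [Function.comp_apply]
    rw [this, ← inner_self_eq_zero (𝕜 := ℂ), inner_gns_cyclicVector]
    exact hf _ (hl _ _ (hr _ _ hs))
  ext v
  exact congrFun h v

/-- The normalized functional of a nonzero vector is a state. -/
theorem vectorState_mem {T : Submodule ℂ B} {H : Type u} [NormedAddCommGroup H]
    [InnerProductSpace ℂ H] [CompleteSpace H] (π : B →⋆ₙₐ[ℂ] (H →L[ℂ] H)) (h1 : π 1 = 1)
    (hT : ∀ s ∈ T, π s = 0) {v : H} (hv : v ≠ 0) :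
    (fun x => ((‖v‖ ^ 2 : ℝ) : ℂ)⁻¹ * ⟪v, π x v⟫_ℂ) ∈ statesVanishingOn T := by
  have hv' : ((‖v‖ ^ 2 : ℝ) : ℂ) ≠ 0 := by
    simpa using hv
  refine ⟨fun x y => ?_, fun r x => ?_, fun x => ?_, ?_, fun s hs => ?_⟩
  · simp [mul_add]
  · simp; ring
  · have : ⟪v, π (star x * x) v⟫_ℂ = ((‖π x v‖ ^ 2 : ℝ) : ℂ) := by
      rw [map_mul, map_star, ContinuousLinearMap.star_eq_adjoint, mul_apply_eq_comp,
        ContinuousLinearMap.adjoint_inner_right, inner_self_eq_norm_sq_to_K]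
      simp
    simp only [this]
    rw [← Complex.ofReal_inv, ← Complex.ofReal_mul]
    exact_mod_cast (by positivity : 0 ≤ (‖v‖ ^ 2)⁻¹ * ‖π x v‖ ^ 2)
  · have : ⟪v, v⟫_ℂ = ((‖v‖ ^ 2 : ℝ) : ℂ) := by
      rw [inner_self_eq_norm_sq_to_K]; simp
    simp only [h1, one_apply_eq_self, this]
    exact inv_mul_cancel₀ hv'
  · simp [hT s hs]

/-- The GNS representation of an extreme state has no nontrivial closed invariant subspaces. -/
theorem gns_eq_bot_or_eq_top {T : Submodule ℂ B} (hl : ∀ x, ∀ s ∈ T, x * s ∈ T)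
    (hr : ∀ x, ∀ s ∈ T, s * x ∈ T) {f : B →ₚ[ℂ] ℂ}
    (hψ : ⇑f ∈ (statesVanishingOn T).extremePoints ℝ) (V : Submodule ℂ f.GNS)
    (hV : IsClosed (V : Set f.GNS)) (hinv : ∀ x : B, ∀ v ∈ V, f.gnsNonUnitalStarAlgHom x v ∈ V) :
    V = ⊥ ∨ V = ⊤ := by
  set π := f.gnsNonUnitalStarAlgHom with hπ
  set Ω := cyclicVector f with hΩ
  have hdense : DenseRange fun x => π x Ω := dense_range_gns_cyclicVector f
  have hπ1 : π 1 = 1 := gns_one f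
  have hπT : ∀ s ∈ T, π s = 0 := fun s hs => gns_eq_zero hl hr f hψ.1.2.2.2.2 hs
  have hψΩ : ∀ x, f x = ⟪Ω, π x Ω⟫_ℂ := by
    intro x
    have := inner_gns_cyclicVector f 1 x
    rw [gns_one, star_one, one_mul] at this
    exact this.symm
  have hadj : ∀ x v w, ⟪v, π x w⟫_ℂ = ⟪π (star x) v, w⟫_ℂ := by
    intro x v w
    rw [map_star, ContinuousLinearMap.star_eq_adjoint, ContinuousLinearMap.adjoint_inner_left]
  have hcyc : ∀ W : Submodule ℂ f.GNS, IsClosed (W : Set f.GNS) → (∀ x, ∀ v ∈ W, π x v ∈ W) →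
      Ω ∈ W → W = ⊤ := by
    intro W hW hWinv hΩW
    refine Submodule.eq_top_iff'.2 fun v => ?_
    have : closure (Set.range fun x => π x Ω) ⊆ (W : Set f.GNS) :=
      closure_minimal (by rintro _ ⟨x, rfl⟩; exact hWinv x Ω hΩW) hW
    exact this (hdense v)
  have hperp : ∀ x, ∀ v ∈ Vᗮ, π x v ∈ Vᗮ := by
    intro x v hv
    rw [Submodule.mem_orthogonal] at hv ⊢
    intro u hu
    rw [hadj]
    exact hv _ (hinv _ _ hu)
  have : CompleteSpace V := hV.completeSpace_coe
  -- Both `V` and its orthogonal complement are invariant, so splitting the cyclic vector as `v + w`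
  -- splits `f` into the vector functionals of `v` and `w`.
  obtain ⟨v, hv, w, hw, hvw⟩ := V.exists_add_mem_mem_orthogonal Ω
  by_cases hv0 : v = 0
  · left
    have hΩperp : Ω ∈ Vᗮ := by rw [hvw, hv0, zero_add]; exact hw
    have := hcyc _ (Submodule.isClosed_orthogonal V) hperp hΩperp
    rwa [Submodule.orthogonal_eq_top_iff] at this
  by_cases hw0 : w = 0
  · right
    exact hcyc V hV hinv (by rw [hvw, hw0, add_zero]; exact hv)
  right
  have hvw0 : ∀ x, ⟪v, π x w⟫_ℂ = 0 := fun x =>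
    (Submodule.mem_orthogonal V _).1 (hperp x w hw) v hv
  have hwv0 : ∀ x, ⟪w, π x v⟫_ℂ = 0 := fun x => by
    rw [hadj, ← inner_conj_symm, (Submodule.mem_orthogonal V _).1 (hperp _ w hw) v hv, map_zero]
  have hsplit : ∀ x, ⟪Ω, π x Ω⟫_ℂ = ⟪v, π x v⟫_ℂ + ⟪w, π x w⟫_ℂ := by
    intro x
    rw [hvw, map_add, inner_add_left, inner_add_right, inner_add_right, hvw0, hwv0]
    ring
  have hnorm : ‖v‖ ^ 2 + ‖w‖ ^ 2 = 1 := by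
    have h := hsplit 1
    rw [← hψΩ, hψ.1.2.2.2.1, hπ1] at h
    simp only [one_apply_eq_self, inner_self_eq_norm_sq_to_K] at h
    have h' : ((1 : ℝ) : ℂ) = ((‖v‖ ^ 2 + ‖w‖ ^ 2 : ℝ) : ℂ) := by push_cast; exact h
    exact (Complex.ofReal_injective h').symm
  have hvpos : 0 < ‖v‖ ^ 2 := by positivity
  have hwpos : 0 < ‖w‖ ^ 2 := by positivity
  have hv' : ((‖v‖ ^ 2 : ℝ) : ℂ) ≠ 0 := by exact_mod_cast hvpos.ne'
  have hw' : ((‖w‖ ^ 2 : ℝ) : ℂ) ≠ 0 := by exact_mod_cast hwpos.ne'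
  -- `f` is a convex combination of two normalized vector states with weights `‖v‖ ^ 2` and `‖w‖ ^
  -- 2`; extremality makes the first equal to `f`. This forces `v = ‖v‖ ^ 2 • Ω`, so that `Ω` lies
  -- in `V`.
  have hext := hψ.2 (vectorState_mem π hπ1 hπT hv0) (vectorState_mem π hπ1 hπT hw0)
    ⟨‖v‖ ^ 2, ‖w‖ ^ 2, hvpos, hwpos, hnorm, by
      funext x
      simp only [Pi.add_apply, Pi.smul_apply, Complex.real_smul]
      rw [mul_inv_cancel_left₀ hv', mul_inv_cancel_left₀ hw', hψΩ, hsplit]⟩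
  have hker : ∀ x, ⟪v - ((‖v‖ ^ 2 : ℝ) : ℂ) • Ω, π x Ω⟫_ℂ = 0 := by
    intro x
    have h1 : ((‖v‖ ^ 2 : ℝ) : ℂ)⁻¹ * ⟪v, π x v⟫_ℂ = ⟪Ω, π x Ω⟫_ℂ := (congrFun hext x).trans (hψΩ x)
    have h2 : ⟪v, π x Ω⟫_ℂ = ⟪v, π x v⟫_ℂ := by
      conv_lhs => rw [hvw, map_add, inner_add_right, hvw0, add_zero]
    rw [inner_sub_left, inner_smul_left, ← h1, h2, Complex.conj_ofReal, mul_inv_cancel_left₀ hv',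
      sub_self]
  have hz : v - ((‖v‖ ^ 2 : ℝ) : ℂ) • Ω = 0 := by
    have : (fun y => ⟪v - ((‖v‖ ^ 2 : ℝ) : ℂ) • Ω, y⟫_ℂ) = fun _ => 0 :=
      hdense.equalizer (by fun_prop) continuous_const (funext hker)
    exact inner_self_eq_zero.1 (congrFun this _)
  refine hcyc V hV hinv ?_
  have : Ω = ((‖v‖ ^ 2 : ℝ) : ℂ)⁻¹ • v :=
    (eq_inv_smul_iff₀ hv').2 (sub_eq_zero.1 hz).symm
  rw [this]
  exact V.smul_mem _ hv

end GNS

/-- A point outside the closure of a self-adjoint two-sided ideal is separated from this ideal by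
a primitive ideal. -/
theorem exists_prim_of_notMem_closure {A : Type u} [NonUnitalCStarAlgebra A] {S : Submodule ℂ A}
    (hl : ∀ x, ∀ s ∈ S, x * s ∈ S) (hr : ∀ x, ∀ s ∈ S, s * x ∈ S) (hs : ∀ s ∈ S, star s ∈ S)
    {c : A} (hc : c ∉ closure (S : Set A)) : ∃ P : Prim A, (∀ s ∈ S, s ∈ P.1) ∧ c ∉ P.1 := by
  -- In the unitization the normalization `φ 1 = 1` is a closed condition, so the states form a
  -- compact set. The isometric embedding keeps `c` away from the closure of the ideal.
  let ι := Unitization.inrNonUnitalStarAlgHom ℂ A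
  let T : Submodule ℂ (Unitization ℂ A) := S.map (Unitization.inrHom ℂ ℂ A)
  have hT : ∀ y, y ∈ T ↔ ∃ s ∈ S, (s : Unitization ℂ A) = y := fun y => Submodule.mem_map
  have hlT : ∀ x, ∀ s ∈ T, x * s ∈ T := by
    intro x _ hsT
    obtain ⟨s, hs', rfl⟩ := (hT _).1 hsT
    induction x using Unitization.ind with
    | inl_add_inr r y =>
      refine (hT _).2 ⟨r • s + y * s, S.add_mem (S.smul_mem _ hs') (hl _ _ hs'), ?_⟩
      simp [add_mul, Unitization.inl_mul_inr]
  have hrT : ∀ x, ∀ s ∈ T, s * x ∈ T := by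
    intro x _ hsT
    obtain ⟨s, hs', rfl⟩ := (hT _).1 hsT
    induction x using Unitization.ind with
    | inl_add_inr r y =>
      refine (hT _).2 ⟨r • s + s * y, S.add_mem (S.smul_mem _ hs') (hr _ _ hs'), ?_⟩
      simp [mul_add, Unitization.inr_mul_inl]
  have hsT : ∀ s ∈ T, star s ∈ T := by
    intro _ hsT
    obtain ⟨s, hs', rfl⟩ := (hT _).1 hsT
    exact (hT _).2 ⟨star s, hs s hs', by simp⟩
  have hcT : (c : Unitization ℂ A) ∉ closure (T : Set (Unitization ℂ A)) := by
    intro h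
    refine hc ?_
    have himg : (T : Set (Unitization ℂ A)) = (fun x : A => (x : Unitization ℂ A)) '' S := rfl
    have hind := (Unitization.isometry_inr (𝕜 := ℂ) (A := A)).isUniformInducing.isInducing
    rw [hind.closure_eq_preimage_closure_image, ← himg]
    exact h
  obtain ⟨ψ, hψ, hψc⟩ :=
    exists_extremePoint_statesVanishingOn (exists_mem_statesVanishingOn hlT hrT hsT hcT)
  set f := toPositiveLinearMap hψ.1 with hf
  let π : A →⋆ₙₐ[ℂ] (f.GNS →L[ℂ] f.GNS) := f.gnsNonUnitalStarAlgHom.comp ι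
  have hπ : ∀ x, π x = f.gnsNonUnitalStarAlgHom (x : Unitization ℂ A) := fun _ => rfl
  have hπc : π c ≠ 0 := by
    intro h0
    refine hψc ?_
    have := inner_gns_cyclicVector f (c : Unitization ℂ A) c
    rw [← hπ, h0, zero_apply, inner_zero_left] at this
    exact this.symm
  refine ⟨⟨TwoSidedIdeal.ker π, f.GNS, inferInstance, inferInstance, inferInstance, π,
    ⟨⟨c, hπc⟩, fun V hV hinv => ?_⟩, rfl⟩, fun s hs' => ?_, fun h => hπc ?_⟩
  -- Adjoined scalars act as scalars, so subspaces invariant under `A` are invariant under the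
  -- unitization.
  · refine gns_eq_bot_or_eq_top hlT hrT hψ V hV fun x v hv => ?_
    induction x using Unitization.ind with
    | inl_add_inr r y =>
      have : (Unitization.inl r : Unitization ℂ A) = r • 1 := by
        rw [← Unitization.algebraMap_eq_inl, Algebra.algebraMap_eq_smul_one]
      rw [map_add, this, map_smul, gns_one]
      exact V.add_mem (V.smul_mem _ hv) (hinv y v hv)
  · rw [TwoSidedIdeal.mem_ker]
    exact gns_eq_zero hlT hrT f hψ.1.2.2.2.2 ((hT _).2 ⟨s, hs', rfl⟩)
  · exact (TwoSidedIdeal.mem_ker π).1 h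

/-! ### Primitive ideals and open covers -/

section PrimitiveIdeals

variable {A : Type u} [NonUnitalCStarAlgebra A]

theorem Prim.star_mem (P : Prim A) {x : A} (hx : x ∈ P.1) : star x ∈ P.1 := by
  obtain ⟨_, H, _, _, _, π, hπ, rfl⟩ := P
  rw [TwoSidedIdeal.mem_ker] at hx ⊢
  rw [map_star, hx, star_zero]

theorem Prim.smul_mem (P : Prim A) (r : ℂ) {x : A} (hx : x ∈ P.1) : r • x ∈ P.1 := by
  obtain ⟨_, H, _, _, _, π, hπ, rfl⟩ := P
  rw [TwoSidedIdeal.mem_ker] at hx ⊢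
  rw [map_smul, hx, smul_zero]

theorem continuous_rep {H : Type u} [NormedAddCommGroup H] [InnerProductSpace ℂ H] [CompleteSpace H]
    (π : A →⋆ₙₐ[ℂ] (H →L[ℂ] H)) : Continuous π :=
  AddMonoidHomClass.continuous_of_bound π 1 fun x => by
    simpa using NonUnitalStarAlgHom.norm_apply_le π x

theorem Prim.isClosed (P : Prim A) : IsClosed {x : A | x ∈ P.1} := by
  obtain ⟨_, H, _, _, _, π, hπ, rfl⟩ := P
  simp only [TwoSidedIdeal.mem_ker]
  exact isClosed_eq (continuous_rep π) continuous_const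

theorem isOpen_setOf_notMem (x : A) : IsOpen {P : Prim A | x ∉ P.1} := by
  rw [← isClosed_compl_iff, isClosed_iff_hull]
  refine ⟨TwoSidedIdeal.span {x}, ?_⟩
  ext P
  simp [hull, TwoSidedIdeal.span_le]

/-- The kernel of a set of primitive ideals, as a subspace of `A`. -/
def kernel (F : Set (Prim A)) : Submodule ℂ A where
  carrier := {x | ∀ P ∈ F, x ∈ P.1}
  add_mem' hx hy P hP := P.1.add_mem (hx P hP) (hy P hP)
  zero_mem' P _ := P.1.zero_mem
  smul_mem' r _ hx P hP := P.smul_mem r (hx P hP)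

theorem mem_of_kernel_subset {F : Set (Prim A)} (hF : IsClosed F) {P : Prim A}
    (h : ∀ x ∈ kernel F, x ∈ P.1) : P ∈ F := by
  obtain ⟨I, rfl⟩ := isClosed_iff_hull.1 hF
  exact fun x hx => h x fun Q hQ => hQ hx

/-- If `c` lies in every primitive ideal outside the union of a family of open sets, then `c` is
approximated by elements of the primitive ideals outside finitely many of these sets. -/
theorem exists_finset_forall_exists_norm_sub_lt {ι : Type*} {U : ι → Set (Prim A)}
    (hU : ∀ i, IsOpen (U i)) {c : A} (hc : ∀ P : Prim A, (∀ i, P ∉ U i) → c ∈ P.1) {η : ℝ}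
    (hη : 0 < η) :
    ∃ t : Finset ι, ∀ P : Prim A, (∀ i ∈ t, P ∉ U i) → ∃ x ∈ P.1, ‖c - x‖ < η := by
  let S : Submodule ℂ A := ⨆ i, kernel (U i)ᶜ
  have hind : ∀ p : A → Prop, (∀ i, ∀ s ∈ kernel (U i)ᶜ, p s) → p 0 →
      (∀ x y, p x → p y → p (x + y)) → ∀ s ∈ S, p s := fun p h1 h0 h2 s hs =>
    Submodule.iSup_induction _ (motive := p) hs h1 h0 h2
  have hle : ∀ i, kernel (U i)ᶜ ≤ S := fun i => le_iSup (fun i => kernel (U i)ᶜ) i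
  have hl : ∀ x, ∀ s ∈ S, x * s ∈ S := fun x => hind _
    (fun i s hs => hle i fun P hP => P.1.mul_mem_left _ _ (hs P hP))
    (by rw [mul_zero]; exact S.zero_mem) (fun y z hy hz => by rw [mul_add]; exact S.add_mem hy hz)
  have hr : ∀ x, ∀ s ∈ S, s * x ∈ S := fun x => hind _
    (fun i s hs => hle i fun P hP => P.1.mul_mem_right _ _ (hs P hP))
    (by rw [zero_mul]; exact S.zero_mem) (fun y z hy hz => by rw [add_mul]; exact S.add_mem hy hz)
  have hs : ∀ s ∈ S, star s ∈ S := hind _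
    (fun i s hs => hle i fun P hP => P.star_mem (hs P hP))
    (by rw [star_zero]; exact S.zero_mem) (fun y z hy hz => by rw [star_add]; exact S.add_mem hy hz)
  -- A primitive ideal containing `S` lies outside every `U i`, hence contains `c`.
  have hcS : c ∈ closure (S : Set A) := by
    by_contra hcS
    obtain ⟨P, hSP, hcP⟩ := exists_prim_of_notMem_closure hl hr hs hcS
    refine hcP (hc P fun i => ?_)
    exact mem_of_kernel_subset (hU i).isClosed_compl fun x hx => hSP x (hle i hx)
  obtain ⟨x, hxS, hx⟩ := Metric.mem_closure_iff.1 hcS η hη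
  -- `S` is an algebraic sum, not a closed one: the approximant involves finitely many indices only.
  obtain ⟨t, ht⟩ := Submodule.mem_iSup_iff_exists_finset.1 hxS
  refine ⟨t, fun P hP => ⟨x, ?_, by rwa [← dist_eq_norm]⟩⟩
  have hsub : (⨆ i ∈ t, kernel (U i)ᶜ) ≤ kernel {P} := by
    refine iSup₂_le fun i hi y hy Q hQ => ?_
    rw [Set.mem_singleton_iff.1 hQ]
    exact hy P (hP i hi)
  exact hsub ht P rfl

end PrimitiveIdeals

/-! ### Where an element is large: relative compactness and separation -/

section Threshold

variable {A : Type u} [NonUnitalCStarAlgebra A]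

/-- The soft threshold function. -/
noncomputable def threshold (ε t : ℝ) : ℝ := t - max (-ε) (min t ε)

theorem continuous_threshold (ε : ℝ) : Continuous (threshold ε) := by
  unfold threshold; fun_prop

theorem threshold_eq_zero {ε t : ℝ} (h : |t| ≤ ε) : threshold ε t = 0 := by
  rw [abs_le] at h
  rw [threshold, min_eq_left h.2, max_eq_right h.1, sub_self]

theorem norm_sub_cfcₙ_threshold_le {b : A} (hb : IsSelfAdjoint b) {ε : ℝ} (hε : 0 ≤ ε) :
    ‖b - cfcₙ (threshold ε) b‖ ≤ ε := by
  have h0 : threshold ε 0 = 0 := threshold_eq_zero (by simpa)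
  have h : b - cfcₙ (threshold ε) b = cfcₙ (fun t => t - threshold ε t) b := by
    rw [cfcₙ_sub (fun t : ℝ => t) (threshold ε) b (by fun_prop) rfl
      (continuous_threshold ε).continuousOn h0, cfcₙ_id' ℝ b]
  rw [h]
  refine norm_cfcₙ_le fun t _ => ?_
  rw [threshold, sub_sub_cancel, Real.norm_eq_abs, abs_le]
  exact ⟨le_max_left _ _, max_le (by linarith) (min_le_right _ _)⟩

/-- The primitive ideals `P` for which the norm of `b + P` exceeds `ε`. -/
def thresholdSet (b : A) (ε : ℝ) : Set (Prim A) := {P | cfcₙ (threshold ε) b ∉ P.1}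

theorem isOpen_thresholdSet (b : A) (ε : ℝ) : IsOpen (thresholdSet b ε) := isOpen_setOf_notMem _

/-- In a representation with kernel `P`, the image of `b` has norm at most `ε`. The threshold
function vanishes on its quasispectrum, and the functional calculus commutes with the
representation. -/
theorem notMem_thresholdSet {b : A} (hb : IsSelfAdjoint b) {ε : ℝ} (hε : 0 ≤ ε) {P : Prim A} {x : A}
    (hx : x ∈ P.1) (hbx : ‖b - x‖ ≤ ε) : P ∉ thresholdSet b ε := by
  rw [thresholdSet, Set.mem_ofPred_eq, not_not]
  obtain ⟨_, H, _, _, _, π, hπ, rfl⟩ := P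
  rw [TwoSidedIdeal.mem_ker] at hx ⊢
  have hn : ‖π b‖ ≤ ε := by
    have : π b = π (b - x) := by rw [map_sub, hx, sub_zero]
    rw [this]
    exact (NonUnitalStarAlgHom.norm_apply_le π _).trans hbx
  have h0 : threshold ε 0 = 0 := threshold_eq_zero (by simpa)
  have hπb : IsSelfAdjoint (π b) := hb.map π
  have hmap : π (cfcₙ (threshold ε) b) = cfcₙ (threshold ε) (π b) :=
    NonUnitalStarAlgHomClass.map_cfcₙ π (threshold ε) b
      (continuous_threshold ε).continuousOn h0 (continuous_rep π) hb hπb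
  rw [hmap, ← norm_le_zero_iff]
  refine norm_cfcₙ_le fun t ht => ?_
  rw [threshold_eq_zero, norm_zero]
  exact (NonUnitalIsometricContinuousFunctionalCalculus.norm_quasispectrum_le (π b) ht hπb).trans hn

theorem thresholdSet_antitone {b : A} (hb : IsSelfAdjoint b) {ε ε' : ℝ} (hε : 0 ≤ ε) (h : ε ≤ ε') :
    thresholdSet b ε' ⊆ thresholdSet b ε := by
  intro P hP
  by_contra hP'
  rw [thresholdSet, Set.mem_ofPred_eq, not_not] at hP'
  exact notMem_thresholdSet hb (hε.trans h) hP' ((norm_sub_cfcₙ_threshold_le hb hε).trans h) hP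

/-- Otherwise `b` would be a limit of its thresholds, all lying in the closed ideal `P`. -/
theorem exists_mem_thresholdSet {b : A} (hb : IsSelfAdjoint b) {P : Prim A} (hbP : b ∉ P.1) :
    ∃ ε : ℝ, 0 < ε ∧ P ∈ thresholdSet b ε := by
  by_contra! h
  refine hbP ?_
  have : b ∈ closure {x : A | x ∈ P.1} := by
    rw [Metric.mem_closure_iff]
    intro ε hε
    have h' := h (ε / 2) (by positivity)
    rw [thresholdSet, Set.mem_ofPred_eq, not_not] at h'
    refine ⟨_, h', ?_⟩
    rw [dist_eq_norm]
    exact (norm_sub_cfcₙ_threshold_le hb (by positivity)).trans_lt (by linarith)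
  rwa [P.isClosed.closure_eq] at this

/-- The relative compactness of the sets `thresholdSet b ε'` in `thresholdSet b ε`. -/
theorem exists_finset_thresholdSet_subset {b : A} (hb : IsSelfAdjoint b) {ε ε' : ℝ} (hε : 0 ≤ ε)
    (h : ε < ε') {ι : Type*} {U : ι → Set (Prim A)} (hU : ∀ i, IsOpen (U i))
    (hcov : thresholdSet b ε ⊆ ⋃ i, U i) :
    ∃ t : Finset ι, thresholdSet b ε' ⊆ ⋃ i ∈ t, U i := by
  -- The tolerance is `ε' - ε`, since thresholding itself moves `b` by at most `ε`.
  obtain ⟨t, ht⟩ := exists_finset_forall_exists_norm_sub_lt hU (c := cfcₙ (threshold ε) b)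
    (fun P hP => by
      by_contra hcP
      obtain ⟨i, hi⟩ := Set.mem_iUnion.1 (hcov (a := P) hcP)
      exact hP i hi) (sub_pos.2 h)
  refine ⟨t, fun P hP => ?_⟩
  by_contra hPt
  simp only [Set.mem_iUnion, not_exists] at hPt
  obtain ⟨x, hxP, hx⟩ := ht P hPt
  refine notMem_thresholdSet hb (hε.trans h.le) hxP ?_ hP
  have h1 : b - x = (b - cfcₙ (threshold ε) b) + (cfcₙ (threshold ε) b - x) := by abel
  rw [h1]
  exact (norm_add_le _ _).trans (by linarith [norm_sub_cfcₙ_threshold_le hb hε])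

/-- A complete regularity property: a function which peaks at `P₀` and vanishes where `b` is
large. -/
theorem exists_continuous_eq_one_eq_zero_on_thresholdSet {b : A} (hb : IsSelfAdjoint b) {ε ε' : ℝ}
    (hε : 0 ≤ ε) (h : ε < ε') {P₀ : Prim A} (hP₀ : ∀ Q, Equivalent P₀ Q → Q ∉ thresholdSet b ε) :
    ∃ f : Prim A → ℝ, Continuous f ∧ (∀ P, 0 ≤ f P) ∧ f P₀ = 1 ∧
      ∀ P ∈ thresholdSet b ε', f P = 0 := by
  have hsep : ∀ Q : thresholdSet b ε, ∃ g : Prim A → ℝ, Continuous g ∧ (∀ P, 0 ≤ g P) ∧ g P₀ = 0 ∧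
      1 < g Q.1 := by
    rintro ⟨Q, hQ⟩
    have hne : ¬ Equivalent P₀ Q := fun hE => hP₀ Q hE hQ
    rw [Equivalent, not_forall] at hne
    obtain ⟨g, hg⟩ := hne
    have hpos : 0 < |g Q - g P₀| := abs_pos.2 (sub_ne_zero.2 (Ne.symm hg))
    -- The factor 2 makes the value at `Q` equal to 2, so the function exceeds 1 on a neighbourhood
    -- of `Q`.
    refine ⟨fun P => 2 * |g P - g P₀| / |g Q - g P₀|, ?_, fun P => by positivity, by simp, ?_⟩
    · have := g.continuous
      fun_prop
    · dsimp only
      rw [mul_div_assoc, div_self hpos.ne']; norm_num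
  choose g hgc hg0 hgP₀ hgQ using hsep
  obtain ⟨t, ht⟩ := exists_finset_thresholdSet_subset hb hε h (U := fun Q => {P | 1 < g Q P})
    (fun Q => isOpen_lt continuous_const (hgc Q))
    (fun Q hQ => Set.mem_iUnion.2 ⟨⟨Q, hQ⟩, hgQ ⟨Q, hQ⟩⟩)
  -- Each `g Q` vanishes at `P₀`, while some `g Q` exceeds 1 at every point of the smaller set.
  refine ⟨fun P => max 0 (1 - ∑ Q ∈ t, g Q P), by fun_prop, fun P => le_max_left _ _, ?_, ?_⟩
  · simp [hgP₀]
  · intro P hP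
    obtain ⟨Q, hQt, hQ⟩ := Set.mem_iUnion₂.1 (ht hP)
    have : g Q P ≤ ∑ Q ∈ t, g Q P := Finset.single_le_sum (fun Q _ => hg0 Q P) hQt
    have hQ' : 1 < g Q P := hQ
    exact max_eq_left (by linarith)

end Threshold

/-! ### Compact subsets of the Glimm space -/

section Glimm

variable {A : Type u} [NonUnitalCStarAlgebra A]

theorem quotientMap_surjective : Function.Surjective (quotientMap (A := A)) := by
  rintro ⟨_, P, rfl⟩
  exact ⟨P, rfl⟩

theorem exists_continuous_comp_quotientMap (f : Prim A →ᵇ ℝ) :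
    ∃ g : Glimm A → ℝ, Continuous g ∧ ∀ P, g (quotientMap P) = f P := by
  let r := Function.surjInv (quotientMap_surjective (A := A))
  have hg : ∀ P, f (r (quotientMap P)) = f P := fun P =>
    quotientMap_eq_iff.1 (Function.surjInv_eq quotientMap_surjective (quotientMap P)) f
  refine ⟨fun G => f (r G), ?_, hg⟩
  exact continuous_iff_le_induced.2 (iInf₂_le _ ⟨f, hg⟩)

/-- Continuous functions on `Prim(A)`, even unbounded ones, are bounded above on the preimages of
compact subsets of `Glimm(A)`. -/
theorem exists_forall_lt_of_isCompact {K : Set (Glimm A)} (hK : IsCompact K) {F : Prim A → ℝ}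
    (hF : Continuous F) (hF0 : ∀ P, 0 ≤ F P) : ∃ n : ℕ, ∀ P, quotientMap P ∈ K → F P < n := by
  -- Only bounded functions are known to drop continuously. The truncation at `n` still detects `F P
  -- < n`, which gives an increasing open cover.
  have hex : ∀ n : ℕ, ∃ g : Glimm A → ℝ, Continuous g ∧ ∀ P, g (quotientMap P) = min (F P) n :=
    fun n => exists_continuous_comp_quotientMap
      (BoundedContinuousFunction.ofNormedAddCommGroup (fun P => min (F P) n) (by fun_prop) n
        fun P => by
          rw [Real.norm_eq_abs, abs_of_nonneg (le_min (hF0 P) n.cast_nonneg)]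
          exact min_le_right _ _)
  choose g hgc hg using hex
  have hlt : ∀ n P, g n (quotientMap P) < n ↔ F P < n := fun n P => by simp [hg]
  obtain ⟨n, hn⟩ := hK.elim_directed_cover (fun n : ℕ => {G | g n G < n})
    (fun n => isOpen_lt (hgc n) continuous_const)
    (fun G _ => by
      obtain ⟨P, rfl⟩ := quotientMap_surjective G
      obtain ⟨n, hn⟩ := exists_nat_gt (F P)
      exact Set.mem_iUnion.2 ⟨n, (hlt n P).2 hn⟩)
    (directed_of_isDirected_le fun m n hmn G hG => by
      obtain ⟨P, rfl⟩ := quotientMap_surjective G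
      exact (hlt n P).2 (((hlt m P).1 hG).trans_le (by exact_mod_cast hmn)))
  exact ⟨n, fun P hP => (hlt n P).1 (hn hP)⟩

theorem exists_mem_norm_sub_lt_of_quotientNorm_lt {a : A} {I : TwoSidedIdeal A} {δ : ℝ}
    (h : quotientNorm a I < δ) : ∃ x ∈ I, ‖a - x‖ < δ := by
  obtain ⟨y, hy, hyδ⟩ := QuotientAddGroup.norm_lt_iff.1 h
  refine ⟨a - y, ?_, by simpa using hyδ⟩
  have := QuotientAddGroup.eq.1 hy
  rw [neg_add_eq_sub] at this
  exact this

/-- A closed ideal containing `a` contains the dense set `aAa`, hence everything, while primitive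
ideals are proper. -/
theorem IsStrictlyPositiveElement.notMem {a : A} (ha : IsStrictlyPositiveElement a) (P : Prim A) :
    a ∉ P.1 := by
  intro haP
  have hsub : {y : A | ∃ x : A, y = a * x * a} ⊆ {x | x ∈ P.1} := by
    rintro _ ⟨x, rfl⟩
    exact P.1.mul_mem_left _ _ haP
  refine P.2.ne_top fun x _ => ?_
  exact closure_minimal hsub P.isClosed (ha x)

theorem star_mul_self_notMem {P : Prim A} {a : A} (ha : a ∉ P.1) : star a * a ∉ P.1 := by
  obtain ⟨_, H, _, _, _, π, hπ, rfl⟩ := P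
  rw [TwoSidedIdeal.mem_ker] at ha ⊢
  rwa [map_mul, map_star, CStarRing.star_mul_self_eq_zero_iff]

/-- If `a` is close to the Glimm ideal of `P₀`, then `star a * a` is small at all points
equivalent to `P₀`. -/
theorem notMem_thresholdSet_of_quotientNorm_lt {a : A} {P₀ : Prim A} {δ : ℝ}
    (h : quotientNorm a (glimmIdeal P₀) < δ) {Q : Prim A} (hQ : Equivalent P₀ Q) :
    Q ∉ thresholdSet (star a * a) (δ ^ 2) := by
  obtain ⟨x, hx, hax⟩ := exists_mem_norm_sub_lt_of_quotientNorm_lt h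
  have hle : glimmIdeal P₀ ≤ Q.1 := sInf_le ⟨Q, hQ, rfl⟩
  have hxQ : x ∈ Q.1 := hle hx
  -- This element of `Q` differs from `star a * a` by `star (a - x) * (a - x)`.
  refine notMem_thresholdSet (.star_mul_self a) (sq_nonneg δ)
    (x := star (a - x) * x + star x * a)
    (Q.1.add_mem (Q.1.mul_mem_left _ _ hxQ) (Q.1.mul_mem_right _ _ (Q.star_mem hxQ))) ?_
  have : star a * a - (star (a - x) * x + star x * a) = star (a - x) * (a - x) := by
    rw [star_sub]; noncomm_ring
  rw [this, CStarRing.norm_star_mul_self, ← sq]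
  gcongr

end Glimm

end GlimmSpace

/-! ### The main theorem -/

open GlimmSpace

theorem theorem2p1 {A : Type u} [NonUnitalCStarAlgebra A]
    (hA : GlimmSpace.HasCountableApproximateIdentity A)
    (a : A) (ha : GlimmSpace.IsStrictlyPositiveElement a)
    (K : Set (GlimmSpace.Glimm A)) (hK : IsCompact K) :
    ∃ α : ℝ, 0 < α ∧ K ⊆ {G : GlimmSpace.Glimm A | α ≤ GlimmSpace.quotientNorm a G.1} := by
  by_contra! hcon
  -- `a` need not be self-adjoint; `star a * a` is, and it lies in the same primitive ideals.
  have hb : IsSelfAdjoint (star a * a) := .star_mul_self a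
  let δ : ℕ → ℝ := fun n => 1 / ((n : ℝ) + 1)
  have hδ : ∀ n, 0 < δ n := fun n => by positivity
  have hex : ∀ n : ℕ, ∃ P : Prim A, quotientMap P ∈ K ∧
      quotientNorm a (glimmIdeal P) < δ n := by
    intro n
    obtain ⟨G, hGK, hG⟩ := Set.not_subset.1 (hcon (δ n) (hδ n))
    obtain ⟨P, rfl⟩ := quotientMap_surjective G
    exact ⟨P, hGK, not_le.1 hG⟩
  choose P hPK hP using hex
  -- Separation needs a level strictly above `δ n ^ 2`, whence `2 * δ n ^ 2`.
  have hf : ∀ n : ℕ, ∃ f : Prim A → ℝ, Continuous f ∧ (∀ Q, 0 ≤ f Q) ∧ f (P n) = 1 ∧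
      ∀ Q ∈ thresholdSet (star a * a) (2 * δ n ^ 2), f Q = 0 := fun n =>
    exists_continuous_eq_one_eq_zero_on_thresholdSet hb (sq_nonneg (δ n))
      (by have := hδ n; nlinarith [sq_pos_of_pos this])
      fun Q hQ => notMem_thresholdSet_of_quotientNorm_lt (hP n) hQ
  choose f hfc hf0 hfP hfz using hf
  have hlim : Tendsto (fun n => 2 * δ n ^ 2) atTop (𝓝 0) := by
    simpa [δ] using (tendsto_one_div_add_atTop_nhds_zero_nat (𝕜 := ℝ)).pow 2 |>.const_mul 2
  have hloc : LocallyFinite fun n : ℕ => Function.support fun Q => (n : ℝ) * f n Q := by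
    intro Q
    obtain ⟨ε, hε, hQ⟩ := exists_mem_thresholdSet hb (star_mul_self_notMem (ha.notMem Q))
    refine ⟨_, (isOpen_thresholdSet _ _).mem_nhds hQ, ?_⟩
    -- Once `2 * δ n ^ 2 ≤ ε`, the function `f n` vanishes on the whole neighbourhood.
    obtain ⟨N, hN⟩ := eventually_atTop.1 (hlim.eventually_le_const hε)
    refine (Set.finite_lt_nat N).subset ?_
    rintro n ⟨R, hR, hRε⟩
    by_contra hn
    refine hR ?_
    have : R ∈ thresholdSet (star a * a) (2 * δ n ^ 2) :=
      thresholdSet_antitone hb (by positivity) (hN n (not_lt.1 hn)) hRε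
    simp only [hfz n R this, mul_zero]
  have hterm : ∀ (n : ℕ) Q, 0 ≤ (n : ℝ) * f n Q := fun n Q => mul_nonneg n.cast_nonneg (hf0 n Q)
  obtain ⟨n, hn⟩ := exists_forall_lt_of_isCompact hK
    (continuous_finsum (fun n => continuous_const.mul (hfc n)) hloc)
    fun Q => finsum_nonneg fun n => hterm n Q
  -- The index is the bound `n` itself: the sum is at least `n` at `P n`, yet less than `n` over
  -- `K`.
  have hle : (n : ℝ) * f n (P n) ≤ ∑ᶠ m : ℕ, (m : ℝ) * f m (P n) :=
    single_le_finsum n (hloc.point_finite (P n)) fun m => hterm m (P n)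
  have hlt := hn (P n) (hPK n)
  rw [hfP, mul_one] at hle
  exact absurd hlt (not_lt.2 hle)
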